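/- Let $N$ be a simply connected Lie group whose Lie algebra $\mathfrak n$ is finite-dimensional and 2-step nilpotent ($[\mathfrak n,\mathfrak n]\subseteq\mathfrak z$, where $\mathfrak z$ is the center of $\mathfrak n$), let $\log:N\to\mathfrak n$ be the inverse of the exponential map, and let $\langle\cdot,\cdot\rangle$ be a nondegenerate symmetric bilinear form on $\mathfrak n$, together with the induced left-invariant pseudoriemannian metric on $N$. Let $\mathfrak n=\mathcal U\oplus\mathcal Z\oplus\mathcal V\oplus\mathcal E$, where $\mathcal U=\mathfrak z\cap\mathfrak z^\perp$, $\mathcal V$ is a null subspace complementary to $\mathcal U$, $\mathcal Z=\mathfrak z\cap\mathcal U^\perp\cap\mathcal V^\perp$, and $\mathcal E$ is the orthogonal complement of $\mathcal Z$ in $\mathcal U^\perp\cap\mathcal V^\perp$. An element $\phi\in N$ translates a geodesic $\gamma:\mathbb R\to N$ by $\omega$ if $\phi\,\gamma(t)=\gamma(t+\omega)$ for all $t$; $\gamma$ has unit speed if $|\langle\dot\gamma,\dot\gamma\rangle|=1$. For a lattice $\Gamma$ in $N$ (a discrete subgroup with $\Gamma\backslash N$ compact), the period spectrum $\mathrm{spec}_\wp(\Gamma\backslash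 N)$ is the set of all periods $\omega>0$ of periodic unit-speed geodesics of $\Gamma\backslash N$ that belong to a nontrivial free homotopy class of closed curves, equivalently to a nontrivial conjugacy class of $\Gamma$. Theorem. Suppose that $[\mathfrak n,\mathfrak n]\subseteq\mathcal U$ and $\mathcal E=\{0\}$. Then: 1. $N$ is flat: $\langle R(x,y)y,x\rangle=0$ for all tangent vectors $x,y$ at any point of $N$. 2. If $\phi\in N$ translates a unit-speed geodesic $\gamma$ by $\omega>0$, and $\log\phi=u^*+z^*+v^*$ with $u^*\in\mathcal U$, $z^*\in\mathcal Z$, $v^*\in\mathcal V$, then $\varepsilon\omega^2=2\langle u^*,v^*\rangle+\langle z^*,z^*\rangle$, where $\varepsilon=\langle\dot\gamma(0),\dot\gamma(0)\rangle=\pm1$. 3. For every lattice $\Gamma$ in $N$ the period spectrum is completely determined by $\log\Gamma\subseteq\mathfrak n$: $\mathrm{spec}_\wp(\Gamma\backslash N)$ is the set of all $\omega>0$ with $\omega^2=|2\langle u^*,v^*\rangle+\langle z^*,z^*\rangle|$ for some $u^*+z^*+v^*\in\log\Gamma$ (with $u^*\in\mathcal U$, $z^*\in\mathcal Z$, $v^*\in\mathcal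 V$) such that $\langle v^*,[v^*,y]\rangle=0$ for all $y\in\log\Gamma$. -/

import Mathlib

open scoped Manifold ContDiff

noncomputable section

namespace PseudoNil

/-- A real Lie algebra together with a norm. On a finite-dimensional Lie algebra the norm only
serves to fix the canonical topology; nothing below depends on which norm is chosen. -/
class NormedLieAlgebra (𝔫 : Type*) extends
  NormedAddCommGroup 𝔫, LieRing 𝔫, NormedSpace ℝ 𝔫, LieAlgebra ℝ 𝔫

/-- `𝔫` is 2-step nilpotent: `[𝔫, 𝔫]` is contained in the center. -/
class TwoStep (𝔫 : Type*) [LieRing 𝔫] [LieAlgebra ℝ 𝔫] : Prop where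
  bracket_mem_center : ∀ x y : 𝔫, ⁅x, y⁆ ∈ LieAlgebra.center ℝ 𝔫

/-- The simply connected Lie group with 2-step nilpotent Lie algebra `𝔫`, built in exponential
coordinates: the constructor is `exp`, the projection is its inverse `log`, and the product is
given by the Baker-Campbell-Hausdorff formula. -/
@[ext] structure NilGroup (𝔫 : Type*) where
  exp ::
  log : 𝔫

namespace NilGroup

section Algebra

variable {𝔫 : Type*} [NormedLieAlgebra 𝔫] [TwoStep 𝔫]

theorem lie_lie_left (x y z : 𝔫) : ⁅⁅x, y⁆, z⁆ = 0 := by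
  have h := (LieModule.mem_maxTrivSubmodule (R := ℝ) (L := 𝔫) (M := 𝔫) ⁅x, y⁆).1
    (TwoStep.bracket_mem_center x y) z
  rw [← lie_skew, h, neg_zero]

theorem lie_lie_right (x y z : 𝔫) : ⁅x, ⁅y, z⁆⁆ = 0 :=
  (LieModule.mem_maxTrivSubmodule (R := ℝ) (L := 𝔫) (M := 𝔫) ⁅y, z⁆).1
    (TwoStep.bracket_mem_center y z) x

/-- `exp x * exp y = exp (x + y + [x, y] / 2)`. -/
instance : Group (NilGroup 𝔫) where
  mul a b := exp (a.log + b.log + (1 / 2 : ℝ) • ⁅a.log, b.log⁆)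
  one := exp 0
  inv a := exp (-a.log)
  mul_assoc a b c := by
    change exp _ = exp _
    congr 1
    change (a.log + b.log + (1 / 2 : ℝ) • ⁅a.log, b.log⁆) + c.log
        + (1 / 2 : ℝ) • ⁅a.log + b.log + (1 / 2 : ℝ) • ⁅a.log, b.log⁆, c.log⁆
      = a.log + (b.log + c.log + (1 / 2 : ℝ) • ⁅b.log, c.log⁆)
        + (1 / 2 : ℝ) • ⁅a.log, b.log + c.log + (1 / 2 : ℝ) • ⁅b.log, c.log⁆⁆
    simp only [add_lie, lie_add, smul_lie, lie_smul, lie_lie_left, lie_lie_right, smul_zero,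
      smul_add, add_zero]
    abel
  one_mul a := by
    change exp ((0 : 𝔫) + a.log + (1 / 2 : ℝ) • ⁅(0 : 𝔫), a.log⁆) = a
    simp
  mul_one a := by
    change exp (a.log + (0 : 𝔫) + (1 / 2 : ℝ) • ⁅a.log, (0 : 𝔫)⁆) = a
    simp
  inv_mul_cancel a := by
    change exp (-a.log + a.log + (1 / 2 : ℝ) • ⁅-a.log, a.log⁆) = exp 0
    simp

theorem log_mul (a b : NilGroup 𝔫) :
    (a * b).log = a.log + b.log + (1 / 2 : ℝ) • ⁅a.log, b.log⁆ := rfl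

theorem log_inv (a : NilGroup 𝔫) : (a⁻¹).log = -a.log := rfl

theorem log_one : (1 : NilGroup 𝔫).log = 0 := rfl

end Algebra

section Topology

variable {𝔫 : Type*} [NormedLieAlgebra 𝔫]

instance : TopologicalSpace (NilGroup 𝔫) := TopologicalSpace.induced log inferInstance

instance : Nonempty (NilGroup 𝔫) := ⟨exp 0⟩

/-- The global chart given by exponential coordinates. -/
def logHomeomorph : NilGroup 𝔫 ≃ₜ 𝔫 where
  toFun := log
  invFun := exp
  left_inv _ := rfl
  right_inv _ := rfl
  continuous_toFun := continuous_induced_dom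
  continuous_invFun := continuous_induced_rng.2 continuous_id

instance : ChartedSpace 𝔫 (NilGroup 𝔫) :=
  (logHomeomorph (𝔫 := 𝔫)).isOpenEmbedding.singletonChartedSpace

instance : IsManifold 𝓘(ℝ, 𝔫) ω (NilGroup 𝔫) :=
  (logHomeomorph (𝔫 := 𝔫)).isOpenEmbedding.isManifold_singleton

instance : SimplyConnectedSpace (NilGroup 𝔫) :=
  (logHomeomorph (𝔫 := 𝔫)).toHomotopyEquiv.simplyConnectedSpace

theorem contMDiff_log : ContMDiff 𝓘(ℝ, 𝔫) 𝓘(ℝ, 𝔫) ω (log : NilGroup 𝔫 → 𝔫) :=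
  contMDiff_isOpenEmbedding (I := 𝓘(ℝ, 𝔫)) (logHomeomorph (𝔫 := 𝔫)).isOpenEmbedding

theorem contMDiff_exp : ContMDiff 𝓘(ℝ, 𝔫) 𝓘(ℝ, 𝔫) ω (exp : 𝔫 → NilGroup 𝔫) :=
  ContMDiff.of_comp_isOpenEmbedding (I := 𝓘(ℝ, 𝔫)) (I' := 𝓘(ℝ, 𝔫))
    (logHomeomorph (𝔫 := 𝔫)).isOpenEmbedding contMDiff_id

theorem contDiff_lie [FiniteDimensional ℝ 𝔫] : ContDiff ℝ ω fun p : 𝔫 × 𝔫 => ⁅p.1, p.2⁆ := by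
  let c : 𝔫 →L[ℝ] 𝔫 →L[ℝ] 𝔫 := LinearMap.toContinuousLinearMap
    (LinearMap.toContinuousLinearMap.toLinearMap ∘ₗ (LieAlgebra.ad ℝ 𝔫 : 𝔫 →ₗ[ℝ] Module.End ℝ 𝔫))
  exact (c.contDiff.comp contDiff_fst).clm_apply contDiff_snd

/-- `NilGroup 𝔫` is a Lie group. -/
instance [FiniteDimensional ℝ 𝔫] [TwoStep 𝔫] : LieGroup 𝓘(ℝ, 𝔫) ω (NilGroup 𝔫) where
  contMDiff_mul := by
    have h : ContDiff ℝ ω fun p : 𝔫 × 𝔫 => p.1 + p.2 + (1 / 2 : ℝ) • ⁅p.1, p.2⁆ :=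
      (contDiff_fst.add contDiff_snd).add (contDiff_const.smul contDiff_lie)
    have hl : ContMDiff (𝓘(ℝ, 𝔫).prod 𝓘(ℝ, 𝔫)) 𝓘(ℝ, 𝔫 × 𝔫) ω
        fun p : NilGroup 𝔫 × NilGroup 𝔫 => (p.1.log, p.2.log) :=
      (contMDiff_log.comp contMDiff_fst).prodMk_space (contMDiff_log.comp contMDiff_snd)
    exact contMDiff_exp.comp (h.contMDiff.comp hl)
  contMDiff_inv := contMDiff_exp.comp (contDiff_neg.contMDiff.comp contMDiff_log)

end Topology

section Geometry

variable {𝔫 : Type*} [NormedLieAlgebra 𝔫] [TwoStep 𝔫]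

/-- Left translation by `n`, in exponential coordinates. -/
def leftTranslation (n : NilGroup 𝔫) (x : 𝔫) : 𝔫 := (n * exp x).log

/-- The left-invariant vector field with value `a` at the identity, in exponential coordinates. -/
def leftInvariantField (a : 𝔫) (p : 𝔫) : 𝔫 := fderiv ℝ (leftTranslation (exp p)) 0 a

theorem leftInvariantField_eq [FiniteDimensional ℝ 𝔫] (a p : 𝔫) :
    leftInvariantField a p = a + (1 / 2 : ℝ) • ⁅p, a⁆ := by
  let c : 𝔫 →L[ℝ] 𝔫 := LinearMap.toContinuousLinearMap (LieAlgebra.ad ℝ 𝔫 p)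
  have h : HasFDerivAt (leftTranslation (exp p))
      (ContinuousLinearMap.id ℝ 𝔫 + (1 / 2 : ℝ) • c) 0 :=
    ((hasFDerivAt_id (0 : 𝔫)).const_add p).add (c.hasFDerivAt.const_smul (1 / 2 : ℝ))
  rw [leftInvariantField, h.fderiv]
  rfl

/-- The Lie algebra of left-invariant vector fields on `NilGroup 𝔫` is `𝔫`. -/
theorem lieBracket_leftInvariantField [FiniteDimensional ℝ 𝔫] (a b p : 𝔫) :
    VectorField.lieBracket ℝ (leftInvariantField a) (leftInvariantField b) p
      = leftInvariantField ⁅a, b⁆ p := by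
  have key : ∀ a p : 𝔫, HasFDerivAt (leftInvariantField a)
      (-((1 / 2 : ℝ) • LinearMap.toContinuousLinearMap (LieAlgebra.ad ℝ 𝔫 a))) p := by
    intro a p
    have e : leftInvariantField a
        = fun q => a + (-((1 / 2 : ℝ) • LinearMap.toContinuousLinearMap (LieAlgebra.ad ℝ 𝔫 a))) q := by
      funext q
      rw [leftInvariantField_eq]
      rw [← lie_skew q a]
      simp [-lie_skew]
    rw [e]
    exact (ContinuousLinearMap.hasFDerivAt _).const_add a
  rw [VectorField.lieBracket, (key a p).fderiv, (key b p).fderiv]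
  simp only [leftInvariantField_eq]
  simp only [neg_apply, smul_apply, LinearMap.coe_toContinuousLinearMap', LieAlgebra.ad_apply,
    lie_add, lie_smul, lie_lie_right, smul_zero, add_zero]
  rw [← lie_skew a b]
  module

end Geometry

end NilGroup

open NilGroup

section Metric

variable {𝔫 : Type*} [NormedLieAlgebra 𝔫] [TwoStep 𝔫] (B : LinearMap.BilinForm ℝ 𝔫)

/-- The left-invariant metric tensor on the group with value `B` at the identity, evaluated on
tangent vectors `a`, `b` at `exp p`, in exponential coordinates. -/
def metric (p a b : 𝔫) : ℝ :=
  B (fderiv ℝ (leftTranslation (exp p)⁻¹) p a) (fderiv ℝ (leftTranslation (exp p)⁻¹) p b)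

/-- The Christoffel symbols of the Levi-Civita connection of `metric B` at `exp p`: the vector
`w = ∇_a b` (for fields `a`, `b` that are constant in exponential coordinates), which is
characterized by `2⟨w, c⟩ = a⟨b, c⟩ + b⟨a, c⟩ - c⟨a, b⟩` for all `c`; it exists and is unique
when `B` is nondegenerate and `𝔫` is finite-dimensional. -/
def christoffel (p a b : 𝔫) : 𝔫 :=
  Classical.epsilon fun w => ∀ c : 𝔫, 2 * metric B p w c =
    fderiv ℝ (fun q => metric B q b c) p a + fderiv ℝ (fun q => metric B q a c) p b
      - fderiv ℝ (fun q => metric B q a b) p c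

/-- The Riemann curvature tensor `R(a, b) c` of `metric B` at `exp p`. -/
def curvature (p a b c : 𝔫) : 𝔫 :=
  fderiv ℝ (fun q => christoffel B q b c) p a - fderiv ℝ (fun q => christoffel B q a c) p b
    + christoffel B p a (christoffel B p b c) - christoffel B p b (christoffel B p a c)

/-- Every tangent plane is homaloidal: `⟨R(a, b) b, a⟩ = 0`. -/
def IsFlat : Prop := ∀ p a b : 𝔫, metric B p (curvature B p a b b) a = 0

/-- `γ` is a geodesic, defined on all of `ℝ`: `∇_γ' γ' = 0`. -/
def IsGeodesic (γ : ℝ → NilGroup 𝔫) : Prop :=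
  ContDiff ℝ 2 (fun t => (γ t).log) ∧
    ∀ t, deriv (deriv fun s => (γ s).log) t
      + christoffel B (γ t).log (deriv (fun s => (γ s).log) t) (deriv (fun s => (γ s).log) t) = 0

/-- `⟨γ', γ'⟩` at time `t`. -/
def speedSq (γ : ℝ → NilGroup 𝔫) (t : ℝ) : ℝ :=
  metric B (γ t).log (deriv (fun s => (γ s).log) t) (deriv (fun s => (γ s).log) t)

/-- `γ` is a geodesic of unit speed: `|⟨γ', γ'⟩| = 1`. -/
def IsUnitSpeedGeodesic (γ : ℝ → NilGroup 𝔫) : Prop :=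
  IsGeodesic B γ ∧ ∀ t, |speedSq B γ t| = 1

/-- `φ` translates `γ` by `T`. -/
def Translates (φ : NilGroup 𝔫) (γ : ℝ → NilGroup 𝔫) (T : ℝ) : Prop :=
  ∀ t, φ * γ t = γ (t + T)

end Metric

section Lattice

variable {𝔫 : Type*} [NormedLieAlgebra 𝔫] [TwoStep 𝔫] (B : LinearMap.BilinForm ℝ 𝔫)
  (Γ : Subgroup (NilGroup 𝔫))

/-- The nilmanifold `Γ \ N`: the orbit space of the action of `Γ` by left translations. -/
abbrev Nilmanifold : Type _ := MulAction.orbitRel.Quotient Γ (NilGroup 𝔫)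

/-- `Γ` is a lattice: it is discrete, and `Γ \ N` is compact. -/
structure IsLattice : Prop where
  discrete : DiscreteTopology Γ
  cocompact : CompactSpace (Nilmanifold Γ)

/-- The projection `N → Γ \ N`. -/
def proj (n : NilGroup 𝔫) : Nilmanifold Γ := Quotient.mk _ n

/-- `log Γ`. -/
def logSet : Set 𝔫 := {x | exp x ∈ Γ}

/-- The periods of the periodic unit-speed geodesics of `Γ \ N` that belong to the free homotopy
class corresponding to the conjugacy class `C` of `Γ`. As `N → Γ \ N` is the universal covering
and a local isometry, the geodesics of `Γ \ N` are the projections of those of `N`; the one that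
lifts to `γ` is periodic with period `T` if it is invariant under the shift by `T`, and the closed
curve it then describes on `[0, T]` belongs to the class of the `φ ∈ Γ` with `γ(T) = φ γ(0)`. -/
def classPeriods (C : ConjClasses Γ) : Set ℝ :=
  {T | 0 < T ∧ ∃ γ : ℝ → NilGroup 𝔫, IsUnitSpeedGeodesic B γ ∧
    (∀ t, proj Γ (γ (t + T)) = proj Γ (γ t)) ∧
    ∃ φ : Γ, ConjClasses.mk φ = C ∧ γ T = (φ : NilGroup 𝔫) * γ 0}

/-- The period spectrum of `Γ \ N`: the union over all nontrivial classes. -/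
def periodSpectrum : Set ℝ := ⋃ C : {C : ConjClasses Γ // C ≠ ConjClasses.mk 1}, classPeriods B Γ C

end Lattice

/-- The decomposition `𝔫 = U ⊕ Z ⊕ V ⊕ E`: `U` is the null part of the center `𝔷`, `V` is a null
subspace complementary to `U`, `Z` is the part of the center in `U^⊥ ∩ V^⊥`, and `E` is the
orthogonal complement of `Z` in `U^⊥ ∩ V^⊥`. -/
structure IsSplitting {𝔫 : Type*} [NormedLieAlgebra 𝔫] (B : LinearMap.BilinForm ℝ 𝔫)
    (U Z V E : Submodule ℝ 𝔫) : Prop where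
  mem_U : ∀ x, x ∈ U ↔ x ∈ LieAlgebra.center ℝ 𝔫 ∧ ∀ y ∈ LieAlgebra.center ℝ 𝔫, B x y = 0
  null_V : ∀ x ∈ V, ∀ y ∈ V, B x y = 0
  mem_Z : ∀ x, x ∈ Z ↔ x ∈ LieAlgebra.center ℝ 𝔫 ∧ (∀ u ∈ U, B x u = 0) ∧ ∀ v ∈ V, B x v = 0
  mem_E : ∀ x, x ∈ E ↔ (∀ u ∈ U, B x u = 0) ∧ (∀ v ∈ V, B x v = 0) ∧ ∀ z ∈ Z, B x z = 0
  isInternal : DirectSum.IsInternal ![U, Z, V, E]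

end PseudoNil

end

/-!
Write `𝔷` for the center. When `[𝔫, 𝔫] ⊆ U` and `E = 0`, two facts hold: `[𝔫, 𝔫] ⊥ 𝔷`, and
`𝔷^⊥ ⊆ 𝔷`. Besides them, the splitting only serves to write `⟨f, f⟩ = 2⟨u, v⟩ + ⟨z, z⟩` for
`f = u + z + v`.

By the first, the metric tensor in exponential coordinates,
`⟨a - [p, a] / 2, b - [p, b] / 2⟩`, is affine in the base point `p`. Hence the Koszul formula is
solved by a bilinear map `G` that does not depend on `p`, with
`2⟨G(a, b), c⟩ = -(⟨b, [a, c]⟩ + ⟨a, [b, c]⟩)` (`exists_koszul_form`, `christoffel_eq`).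
The values of `G` are orthogonal to `𝔷`, hence central, and `G` vanishes as soon as one argument is
orthogonal to `𝔷`. So every term of the curvature vanishes (`isFlat_of_koszul`), and along a
geodesic `G(γ', γ')` is constant, so that geodesics are the parabolas `x₀ + t a - t² G(a, a) / 2`
(`IsGeodesic.log_eq`).

If `φ = exp f` translates such a parabola by `T`, comparing coefficients of powers of `t` gives
`G(a, a) = 0` and `f + [f, x₀] / 2 = T a`, whence `⟨γ', γ'⟩ T² = ⟨f, f⟩` and `⟨f, [f, y]⟩ = 0` for
all `y` (`speedSq_mul_sq_and_apply_lie_eq_zero`). Conversely, under this last condition `φ`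
translates the geodesic `t ↦ exp ((t / T) f)` by `T`.

For a lattice `Γ`, a continuous lift to `N` of a closed geodesic is translated by an element of `Γ`
because `Γ` is discrete (`mul_eq_of_proj_eq`). The condition `⟨f, [f, y]⟩ = 0` needs to hold only
for `y ∈ log Γ`: the functional `y ↦ ⟨f, [f, y]⟩` kills brackets, so it is a homomorphism on `N`; if
it kills `log Γ`, it descends to the compact space `Γ \ N`, so it is bounded, so it is zero
(`eq_zero_of_eq_zero_on_logSet`).
-/

noncomputable section

namespace PseudoNil

open NilGroup

variable {𝔫 : Type*} [NormedLieAlgebra 𝔫]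

/-! ### The splitting -/

section Splitting

variable {B : LinearMap.BilinForm ℝ 𝔫} {U Z V E : Submodule ℝ 𝔫}

theorem IsSplitting.exists_add_eq (h : IsSplitting B U Z V E) (hE : E = ⊥) (x : 𝔫) :
    ∃ u ∈ U, ∃ z ∈ Z, ∃ v ∈ V, u + z + v = x := by
  have hx : x ∈ ⨆ i, (![U, Z, V, E] : Fin 4 → Submodule ℝ 𝔫) i := by
    rw [h.isInternal.submodule_iSup_eq_top]
    trivial
  obtain ⟨f, hf, rfl⟩ := (Submodule.mem_iSup_iff_exists_finsupp _ x).1 hx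
  have h3 : f 3 = 0 := by simpa [hE] using hf 3
  refine ⟨f 0, hf 0, f 1, hf 1, f 2, hf 2, ?_⟩
  rw [Finsupp.sum_fintype _ _ fun _ => rfl, Fin.sum_univ_four, h3, add_zero]

/-- Without an `E` component, a vector orthogonal to the center has no `V` component (that one
would be orthogonal to `U`, `Z` and `V`) and no `Z` component. -/
theorem IsSplitting.mem_center_of_perp (h : IsSplitting B U Z V E) (hE : E = ⊥)
    (hsymm : B.IsSymm) (hB : B.Nondegenerate) {w : 𝔫}
    (hw : ∀ c ∈ LieAlgebra.center ℝ 𝔫, B w c = 0) : w ∈ LieAlgebra.center ℝ 𝔫 := by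
  obtain ⟨u, hu, z, hz, v, hv, rfl⟩ := h.exists_add_eq hE w
  have hUU : ∀ x ∈ U, ∀ y ∈ U, B x y = 0 := fun x hx y hy =>
    ((h.mem_U x).1 hx).2 y ((h.mem_U y).1 hy).1
  have hZU := fun x hx => ((h.mem_Z x).1 hx).2.1
  have hZV := fun x hx => ((h.mem_Z x).1 hx).2.2
  have hv0 : v = 0 := by
    refine hB.1 v fun y => ?_
    obtain ⟨u', hu', z', hz', v', hv', rfl⟩ := h.exists_add_eq hE y
    have h1 := hw u' ((h.mem_U u').1 hu').1
    rw [map_add, map_add, LinearMap.add_apply, LinearMap.add_apply, hUU u hu u' hu',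
      hZU z hz u' hu', zero_add, zero_add] at h1
    rw [map_add, map_add, h1, hsymm.eq, hZV z' hz' v hv, h.null_V v hv v' hv']
    simp
  have hz0 : z = 0 := by
    refine hB.1 z fun y => ?_
    obtain ⟨u', hu', z', hz', v', hv', rfl⟩ := h.exists_add_eq hE y
    have h1 := hw z' ((h.mem_Z z').1 hz').1
    rw [hv0, add_zero, map_add, LinearMap.add_apply, hsymm.eq u z', hZU z' hz' u hu,
      zero_add] at h1
    rw [map_add, map_add, h1, hZU z hz u' hu', hZV z hz v' hv']
    simp
  rw [hv0, hz0, add_zero, add_zero]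
  exact ((h.mem_U u).1 hu).1

theorem IsSplitting.apply_self (h : IsSplitting B U Z V E) (hsymm : B.IsSymm) {u z v : 𝔫}
    (hu : u ∈ U) (hz : z ∈ Z) (hv : v ∈ V) :
    B (u + z + v) (u + z + v) = 2 * B u v + B z z := by
  have huu : B u u = 0 := ((h.mem_U u).1 hu).2 u ((h.mem_U u).1 hu).1
  have hzu : B z u = 0 := ((h.mem_Z z).1 hz).2.1 u hu
  have hzv : B z v = 0 := ((h.mem_Z z).1 hz).2.2 v hv
  have huz : B u z = 0 := hsymm.eq u z ▸ hzu
  have hvz : B v z = 0 := hsymm.eq v z ▸ hzv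
  have hvv : B v v = 0 := h.null_V v hv v hv
  simp only [map_add, LinearMap.add_apply, huu, hzu, hzv, huz, hvz, hvv, hsymm.eq v u]
  ring

end Splitting

/-! ### The Koszul formula at the identity -/

theorem lie_eq_zero_of_mem_center {w : 𝔫} (hw : w ∈ LieAlgebra.center ℝ 𝔫) (x : 𝔫) :
    ⁅x, w⁆ = 0 :=
  (LieModule.mem_maxTrivSubmodule (R := ℝ) (L := 𝔫) (M := 𝔫) w).1 hw x

theorem lie_eq_zero_of_mem_center_left {w : 𝔫} (hw : w ∈ LieAlgebra.center ℝ 𝔫) (x : 𝔫) :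
    ⁅w, x⁆ = 0 := by
  rw [← lie_skew, lie_eq_zero_of_mem_center hw, neg_zero]

/-- The solution `G` of the Koszul formula at the identity takes values orthogonal to the
center. -/
theorem koszul_perp_center {B : LinearMap.BilinForm ℝ 𝔫} {G : 𝔫 →ₗ[ℝ] 𝔫 →ₗ[ℝ] 𝔫}
    (hG : ∀ a b c, 2 * B (G a b) c = -(B b ⁅a, c⁆ + B a ⁅b, c⁆))
    (a b : 𝔫) {c : 𝔫} (hc : c ∈ LieAlgebra.center ℝ 𝔫) : B (G a b) c = 0 := by
  have h := hG a b c
  rw [lie_eq_zero_of_mem_center hc, lie_eq_zero_of_mem_center hc, map_zero, map_zero] at h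
  linarith

/-- The solution `G` of the Koszul formula vanishes on the orthogonal complement of the center. -/
theorem koszul_right_eq_zero {B : LinearMap.BilinForm ℝ 𝔫} {G : 𝔫 →ₗ[ℝ] 𝔫 →ₗ[ℝ] 𝔫}
    (hsymm : B.IsSymm) (hB : B.Nondegenerate)
    (hperp : ∀ x y : 𝔫, ∀ c ∈ LieAlgebra.center ℝ 𝔫, B ⁅x, y⁆ c = 0)
    (hcoiso : ∀ w : 𝔫, (∀ c ∈ LieAlgebra.center ℝ 𝔫, B w c = 0) → w ∈ LieAlgebra.center ℝ 𝔫)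
    (hG : ∀ a b c, 2 * B (G a b) c = -(B b ⁅a, c⁆ + B a ⁅b, c⁆)) (a : 𝔫) {w : 𝔫}
    (hw : ∀ c ∈ LieAlgebra.center ℝ 𝔫, B w c = 0) : G a w = 0 := by
  refine hB.1 _ fun c => ?_
  have h := hG a w c
  rw [hsymm.eq w, hperp a c w (hcoiso w hw), lie_eq_zero_of_mem_center_left (hcoiso w hw),
    map_zero] at h
  linarith

theorem koszul_symm {B : LinearMap.BilinForm ℝ 𝔫} {G : 𝔫 →ₗ[ℝ] 𝔫 →ₗ[ℝ] 𝔫}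
    (hB : B.Nondegenerate)
    (hG : ∀ a b c, 2 * B (G a b) c = -(B b ⁅a, c⁆ + B a ⁅b, c⁆)) (a b : 𝔫) : G a b = G b a := by
  rw [← sub_eq_zero]
  refine hB.1 _ fun c => ?_
  have h := hG a b c
  have h' := hG b a c
  rw [map_sub, LinearMap.sub_apply]
  linarith

variable [FiniteDimensional ℝ 𝔫]

/-- The bilinear map `G` that solves the Koszul formula at the identity. -/
theorem exists_koszul_form {B : LinearMap.BilinForm ℝ 𝔫} (hB : B.Nondegenerate) :
    ∃ G : 𝔫 →ₗ[ℝ] 𝔫 →ₗ[ℝ] 𝔫,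
      ∀ a b c, 2 * B (G a b) c = -(B b ⁅a, c⁆ + B a ⁅b, c⁆) := by
  let ad : 𝔫 →ₗ[ℝ] Module.End ℝ 𝔫 := LieAlgebra.ad ℝ 𝔫
  -- `J a b` is the image of `b` under the adjoint of `ad a`.
  let J : 𝔫 →ₗ[ℝ] 𝔫 →ₗ[ℝ] 𝔫 := LinearMap.mk₂ ℝ
    (fun a b => (B.toDual hB).symm (B b ∘ₗ ad a))
    (fun a a' b => by rw [map_add, LinearMap.comp_add, map_add])
    (fun r a b => by rw [map_smul, LinearMap.comp_smul, map_smul])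
    (fun a b b' => by rw [map_add, LinearMap.add_comp, map_add])
    (fun r a b => by rw [map_smul, LinearMap.smul_comp, map_smul])
  have hJ : ∀ a b c, B (J a b) c = B b ⁅a, c⁆ := fun a b c =>
    LinearMap.BilinForm.apply_toDual_symm_apply (hB := hB) (B b ∘ₗ ad a) c
  refine ⟨(-(1 / 2) : ℝ) • (J + J.flip), fun a b c => ?_⟩
  simp only [LinearMap.smul_apply, LinearMap.add_apply, LinearMap.flip_apply, map_smul, map_add,
    hJ, smul_eq_mul]
  ring

/-! ### The metric in exponential coordinates -/

variable [TwoStep 𝔫]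

theorem metric_eq (B : LinearMap.BilinForm ℝ 𝔫) (p a b : 𝔫) :
    metric B p a b = B (a - (1 / 2 : ℝ) • ⁅p, a⁆) (b - (1 / 2 : ℝ) • ⁅p, b⁆) := by
  let c : 𝔫 →L[ℝ] 𝔫 := LinearMap.toContinuousLinearMap (LieAlgebra.ad ℝ 𝔫 (-p))
  have h : HasFDerivAt (leftTranslation (exp p)⁻¹)
      (ContinuousLinearMap.id ℝ 𝔫 + (1 / 2 : ℝ) • c) p :=
    ((hasFDerivAt_id p).const_add (-p)).add (c.hasFDerivAt.const_smul (1 / 2 : ℝ))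
  have e : ∀ a, fderiv ℝ (leftTranslation (exp p)⁻¹) p a = a - (1 / 2 : ℝ) • ⁅p, a⁆ := by
    intro a
    rw [h.fderiv]
    change a + (1 / 2 : ℝ) • ⁅-p, a⁆ = _
    rw [neg_lie, smul_neg, sub_eq_add_neg]
  rw [metric, e, e]

/-- When brackets are orthogonal to the center, the metric is affine in the base point. -/
theorem metric_eq_affine {B : LinearMap.BilinForm ℝ 𝔫}
    (hperp : ∀ x y : 𝔫, ∀ c ∈ LieAlgebra.center ℝ 𝔫, B ⁅x, y⁆ c = 0) (p a b : 𝔫) :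
    metric B p a b = B a b + (-(1 / 2) : ℝ) * (B ⁅p, a⁆ b + B a ⁅p, b⁆) := by
  rw [metric_eq]
  simp only [map_sub, map_smul, LinearMap.sub_apply, LinearMap.smul_apply, smul_eq_mul,
    hperp p a _ (TwoStep.bracket_mem_center p b)]
  ring

theorem fderiv_metric {B : LinearMap.BilinForm ℝ 𝔫}
    (hperp : ∀ x y : 𝔫, ∀ c ∈ LieAlgebra.center ℝ 𝔫, B ⁅x, y⁆ c = 0) (p a b c : 𝔫) :
    fderiv ℝ (fun q => metric B q a b) p c = (-(1 / 2) : ℝ) * (B ⁅c, a⁆ b + B a ⁅c, b⁆) := by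
  let ad : 𝔫 →ₗ[ℝ] Module.End ℝ 𝔫 := LieAlgebra.ad ℝ 𝔫
  let l : 𝔫 →ₗ[ℝ] ℝ := (-(1 / 2) : ℝ) • (B.flip b ∘ₗ ad.flip a + B a ∘ₗ ad.flip b)
  have e : (fun q => metric B q a b) = fun q => B a b + LinearMap.toContinuousLinearMap l q :=
    funext fun q => metric_eq_affine hperp q a b
  rw [e, ((ContinuousLinearMap.hasFDerivAt _).const_add _).fderiv]
  rfl

/-- The metric is nondegenerate at every point. -/
theorem metric_left_injective {B : LinearMap.BilinForm ℝ 𝔫} (hB : B.Nondegenerate) {p w w' : 𝔫}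
    (h : ∀ c, metric B p w c = metric B p w' c) : w = w' := by
  have h1 : w - (1 / 2 : ℝ) • ⁅p, w⁆ = w' - (1 / 2 : ℝ) • ⁅p, w'⁆ := by
    rw [← sub_eq_zero]
    refine hB.1 _ fun y => ?_
    -- Left translation back to `p` maps `y + [p, y] / 2` to `y`.
    have h2 := h (y + (1 / 2 : ℝ) • ⁅p, y⁆)
    rw [metric_eq, metric_eq] at h2
    have e : y + (1 / 2 : ℝ) • ⁅p, y⁆ - (1 / 2 : ℝ) • ⁅p, y + (1 / 2 : ℝ) • ⁅p, y⁆⁆ = y := by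
      rw [lie_add, lie_smul, lie_lie_right, smul_zero, add_zero, add_sub_cancel_right]
    rw [e] at h2
    rw [map_sub, LinearMap.sub_apply, h2, sub_self]
  have h3 : ⁅p, w⁆ = ⁅p, w'⁆ := by
    have h4 := congrArg (fun x => ⁅p, x⁆) h1
    simpa only [lie_sub, lie_smul, lie_lie_right, smul_zero, sub_zero] using h4
  rw [h3] at h1
  exact sub_left_injective h1

/-! ### The Levi-Civita connection and flatness -/

section Koszul

variable {B : LinearMap.BilinForm ℝ 𝔫} {G : 𝔫 →ₗ[ℝ] 𝔫 →ₗ[ℝ] 𝔫}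

/-- In exponential coordinates the Christoffel symbols are constant. -/
theorem christoffel_eq (hsymm : B.IsSymm) (hB : B.Nondegenerate)
    (hperp : ∀ x y : 𝔫, ∀ c ∈ LieAlgebra.center ℝ 𝔫, B ⁅x, y⁆ c = 0)
    (hcoiso : ∀ w : 𝔫, (∀ c ∈ LieAlgebra.center ℝ 𝔫, B w c = 0) → w ∈ LieAlgebra.center ℝ 𝔫)
    (hG : ∀ a b c, 2 * B (G a b) c = -(B b ⁅a, c⁆ + B a ⁅b, c⁆)) (p a b : 𝔫) :
    christoffel B p a b = G a b := by
  have key : ∀ c : 𝔫, 2 * metric B p (G a b) c =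
      fderiv ℝ (fun q => metric B q b c) p a + fderiv ℝ (fun q => metric B q a c) p b
        - fderiv ℝ (fun q => metric B q a b) p c := by
    intro c
    have h1 : metric B p (G a b) c = B (G a b) c := by
      rw [metric_eq_affine hperp, lie_eq_zero_of_mem_center
        (hcoiso _ fun c hc => koszul_perp_center hG a b hc), koszul_perp_center hG a b
        (TwoStep.bracket_mem_center p c)]
      simp
    rw [h1, hG, fderiv_metric hperp, fderiv_metric hperp, fderiv_metric hperp,
      hsymm.eq ⁅a, b⁆, hsymm.eq ⁅b, a⁆, hsymm.eq ⁅c, a⁆, ← lie_skew b a, ← lie_skew c a,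
      ← lie_skew c b]
    simp only [map_neg]
    ring
  refine metric_left_injective hB (p := p) fun c => ?_
  have h2 := Classical.epsilon_spec
    (p := fun w => ∀ c : 𝔫, 2 * metric B p w c =
      fderiv ℝ (fun q => metric B q b c) p a + fderiv ℝ (fun q => metric B q a c) p b
        - fderiv ℝ (fun q => metric B q a b) p c) ⟨G a b, key⟩ c
  change 2 * metric B p (christoffel B p a b) c = _ at h2
  have h3 := key c
  linarith

theorem isFlat_of_koszul (hsymm : B.IsSymm) (hB : B.Nondegenerate)
    (hperp : ∀ x y : 𝔫, ∀ c ∈ LieAlgebra.center ℝ 𝔫, B ⁅x, y⁆ c = 0)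
    (hcoiso : ∀ w : 𝔫, (∀ c ∈ LieAlgebra.center ℝ 𝔫, B w c = 0) → w ∈ LieAlgebra.center ℝ 𝔫)
    (hG : ∀ a b c, 2 * B (G a b) c = -(B b ⁅a, c⁆ + B a ⁅b, c⁆)) : IsFlat B := by
  intro p a b
  have h : curvature B p a b b = 0 := by
    simp only [curvature, christoffel_eq hsymm hB hperp hcoiso hG]
    rw [koszul_right_eq_zero hsymm hB hperp hcoiso hG _ fun c hc => koszul_perp_center hG _ _ hc,
      koszul_right_eq_zero hsymm hB hperp hcoiso hG _ fun c hc => koszul_perp_center hG _ _ hc]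
    simp
  rw [h, metric_eq]
  simp

/-! ### Geodesics -/

/-- Geodesics are parabolas in exponential coordinates. -/
theorem IsGeodesic.log_eq (hsymm : B.IsSymm) (hB : B.Nondegenerate)
    (hperp : ∀ x y : 𝔫, ∀ c ∈ LieAlgebra.center ℝ 𝔫, B ⁅x, y⁆ c = 0)
    (hcoiso : ∀ w : 𝔫, (∀ c ∈ LieAlgebra.center ℝ 𝔫, B w c = 0) → w ∈ LieAlgebra.center ℝ 𝔫)
    (hG : ∀ a b c, 2 * B (G a b) c = -(B b ⁅a, c⁆ + B a ⁅b, c⁆)) {γ : ℝ → NilGroup 𝔫}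
    (hγ : IsGeodesic B γ) (t : ℝ) :
    (γ t).log = (γ 0).log + t • deriv (fun s => (γ s).log) 0
      - (t ^ 2 / 2) • G (deriv (fun s => (γ s).log) 0) (deriv (fun s => (γ s).log) 0) := by
  obtain ⟨hs, hode⟩ := hγ
  simp only [christoffel_eq hsymm hB hperp hcoiso hG] at hode
  set x : ℝ → 𝔫 := fun s => (γ s).log with hx
  have hx1 : ∀ s, HasDerivAt x (deriv x s) s := fun s =>
    (hs.differentiable two_ne_zero s).hasDerivAt
  have hx2 : ∀ s, HasDerivAt (deriv x) (-G (deriv x s) (deriv x s)) s := fun s => by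
    rw [← eq_neg_of_add_eq_zero_left (hode s)]
    exact (hs.differentiable_deriv_two s).hasDerivAt
  -- The acceleration is orthogonal to the center, so the velocity is constant modulo `𝔷^⊥`.
  have hv : ∀ s, ∀ c ∈ LieAlgebra.center ℝ 𝔫, B (deriv x s - deriv x 0) c = 0 := by
    intro s c hc
    have hd : ∀ r, HasDerivAt (fun r => B (deriv x r) c) 0 r := fun r => by
      have h := (LinearMap.toContinuousLinearMap (B.flip c)).hasFDerivAt.comp_hasDerivAt r (hx2 r)
      have e : LinearMap.toContinuousLinearMap (B.flip c) (-G (deriv x r) (deriv x r)) = 0 := by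
        change B (-G (deriv x r) (deriv x r)) c = 0
        rw [map_neg, LinearMap.neg_apply, koszul_perp_center hG _ _ hc, neg_zero]
      rw [e] at h
      exact h
    have h := is_const_of_deriv_eq_zero (fun r => (hd r).differentiableAt)
      (fun r => (hd r).deriv) s 0
    rw [map_sub, LinearMap.sub_apply, h, sub_self]
  have hconst : ∀ s, G (deriv x s) (deriv x s) = G (deriv x 0) (deriv x 0) := by
    intro s
    have h1 : ∀ a, G a (deriv x s) = G a (deriv x 0) := fun a => by
      rw [← sub_eq_zero, ← map_sub, koszul_right_eq_zero hsymm hB hperp hcoiso hG a (hv s)]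
    rw [h1, koszul_symm hB hG, h1]
  set k := G (deriv x 0) (deriv x 0) with hk
  have hvel : ∀ s, deriv x s = deriv x 0 - s • k := by
    intro s
    have hd : ∀ r, HasDerivAt (fun r => deriv x r + r • k) 0 r := fun r => by
      have h := (hx2 r).add ((hasDerivAt_id r).smul_const k)
      rw [hconst r, one_smul, neg_add_cancel] at h
      exact h
    have h := is_const_of_deriv_eq_zero (fun r => (hd r).differentiableAt)
      (fun r => (hd r).deriv) s 0
    simp only [zero_smul, add_zero] at h
    exact eq_sub_of_add_eq h
  have hd : ∀ r, HasDerivAt (fun r : ℝ => x r - r • deriv x 0 + (r ^ 2 / 2) • k) 0 r := fun r => by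
    have h2 : HasDerivAt (fun r : ℝ => r ^ 2 / 2) r r := by
      have h := (hasDerivAt_pow 2 r).div_const 2
      have e : ((2 : ℕ) : ℝ) * r ^ (2 - 1) / 2 = r := by norm_num
      rwa [e] at h
    have h := ((hx1 r).sub ((hasDerivAt_id r).smul_const (deriv x 0))).add (h2.smul_const k)
    have e : deriv x r - (1 : ℝ) • deriv x 0 + r • k = 0 := by
      rw [hvel r]
      module
    rw [e] at h
    exact h
  have h := is_const_of_deriv_eq_zero (fun r => (hd r).differentiableAt)
    (fun r => (hd r).deriv) t 0
  have h0 : x t - t • deriv x 0 + (t ^ 2 / 2) • k = x 0 := by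
    rw [h]
    simp
  change x t = x 0 + t • deriv x 0 - (t ^ 2 / 2) • k
  rw [← h0]
  module

theorem speedSq_eq (hsymm : B.IsSymm)
    (hperp : ∀ x y : 𝔫, ∀ c ∈ LieAlgebra.center ℝ 𝔫, B ⁅x, y⁆ c = 0) (γ : ℝ → NilGroup 𝔫) (t : ℝ) :
    speedSq B γ t = B (deriv (fun s => (γ s).log) t) (deriv (fun s => (γ s).log) t)
      - B (deriv (fun s => (γ s).log) t) ⁅(γ t).log, deriv (fun s => (γ s).log) t⁆ := by
  rw [speedSq, metric_eq_affine hperp, hsymm.eq ⁅(γ t).log, _⁆]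
  ring

/-- A translation by `φ` forces the geodesic to be a straight line in exponential coordinates,
with velocity `T⁻¹ (f + [f, x₀] / 2)` where `f = log φ`. -/
theorem speedSq_mul_sq_and_apply_lie_eq_zero (hsymm : B.IsSymm) (hB : B.Nondegenerate)
    (hperp : ∀ x y : 𝔫, ∀ c ∈ LieAlgebra.center ℝ 𝔫, B ⁅x, y⁆ c = 0)
    (hcoiso : ∀ w : 𝔫, (∀ c ∈ LieAlgebra.center ℝ 𝔫, B w c = 0) → w ∈ LieAlgebra.center ℝ 𝔫)
    {γ : ℝ → NilGroup 𝔫} (hγ : IsGeodesic B γ) {φ : NilGroup 𝔫} {T : ℝ} (hT : T ≠ 0)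
    (hφ : Translates φ γ T) :
    speedSq B γ 0 * T ^ 2 = B φ.log φ.log ∧ ∀ y, B φ.log ⁅φ.log, y⁆ = 0 := by
  obtain ⟨G, hG⟩ := exists_koszul_form hB
  have hx := hγ.log_eq hsymm hB hperp hcoiso hG
  rw [speedSq_eq hsymm hperp]
  set a := deriv (fun s => (γ s).log) 0
  set x₀ := (γ 0).log
  set f := φ.log
  have hkc : G a a ∈ LieAlgebra.center ℝ 𝔫 :=
    hcoiso _ fun c hc => koszul_perp_center hG a a hc
  have htr : ∀ t, f + (γ t).log + (1 / 2 : ℝ) • ⁅f, (γ t).log⁆ = (γ (t + T)).log := fun t => by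
    rw [← hφ t, log_mul]
  have h0 : f + (1 / 2 : ℝ) • ⁅f, x₀⁆ = T • a - (T ^ 2 / 2) • G a a := by
    have h := htr 0
    rw [zero_add, hx T] at h
    change f + x₀ + (1 / 2 : ℝ) • ⁅f, x₀⁆ = _ at h
    rw [← sub_eq_zero] at h ⊢
    rw [← h]
    module
  have hfa : ⁅f, a⁆ = 0 := by
    have h := congrArg (fun w => ⁅w, a⁆) h0
    simpa only [add_lie, smul_lie, sub_lie, lie_lie_left, smul_zero, add_zero, lie_self,
      lie_eq_zero_of_mem_center_left hkc, sub_zero] using h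
  have hk : G a a = 0 := by
    -- This compares the coefficients of `t` on both sides of `φ γ(t) = γ(t + T)`.
    have h := htr 1
    rw [hx (1 + T), hx 1] at h
    simp only [lie_add, lie_sub, lie_smul, hfa, lie_eq_zero_of_mem_center hkc, smul_zero, add_zero,
      sub_zero] at h
    have h2 : T • G a a = 0 := by
      rw [← sub_eq_zero] at h h0
      calc T • G a a = _ - _ := ?_
        _ = 0 - 0 := congrArg₂ (· - ·) h h0
        _ = 0 := sub_zero 0
      module
    exact (smul_eq_zero.1 h2).resolve_left hT
  rw [hk, smul_zero, sub_zero] at h0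
  have hfl : ∀ y : 𝔫, ⁅f, y⁆ = T • ⁅a, y⁆ := fun y => by
    have h := congrArg (fun w => ⁅w, y⁆) h0
    simpa only [add_lie, smul_lie, lie_lie_left, smul_zero, add_zero] using h
  have haa : ∀ y : 𝔫, B a ⁅a, y⁆ = 0 := fun y => by
    have h := hG a a y
    rw [hk, map_zero, LinearMap.zero_apply] at h
    linarith
  have hff : ∀ y : 𝔫, B f ⁅f, y⁆ = 0 := fun y => by
    have h : B (f + (1 / 2 : ℝ) • ⁅f, x₀⁆) ⁅f, y⁆ = 0 := by
      rw [h0, hfl, map_smul, map_smul, LinearMap.smul_apply, haa, smul_zero, smul_zero]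
    rwa [map_add, map_smul, LinearMap.add_apply, LinearMap.smul_apply,
      hperp f x₀ _ (TwoStep.bracket_mem_center f y), smul_zero, add_zero] at h
  refine ⟨?_, hff⟩
  have hsq : B (T • a) (T • a) = B f f := by
    rw [← h0]
    simp only [map_add, map_smul, LinearMap.add_apply, LinearMap.smul_apply, hff, smul_eq_mul,
      hsymm.eq ⁅f, x₀⁆ f, hperp f x₀ _ (TwoStep.bracket_mem_center f x₀)]
    ring
  rw [← hsq, ← lie_skew x₀ a, map_neg, haa]
  simp only [map_smul, LinearMap.smul_apply, smul_eq_mul]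
  ring

/-- The geodesic through the identity that is translated by `exp f`. -/
theorem isUnitSpeedGeodesic_line (hsymm : B.IsSymm) (hB : B.Nondegenerate)
    (hperp : ∀ x y : 𝔫, ∀ c ∈ LieAlgebra.center ℝ 𝔫, B ⁅x, y⁆ c = 0)
    (hcoiso : ∀ w : 𝔫, (∀ c ∈ LieAlgebra.center ℝ 𝔫, B w c = 0) → w ∈ LieAlgebra.center ℝ 𝔫)
    {f : 𝔫} (hf : ∀ y, B f ⁅f, y⁆ = 0) {T : ℝ} (hT : 0 < T) (hfT : T ^ 2 = |B f f|) :
    IsUnitSpeedGeodesic B fun t => exp ((t / T) • f) := by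
  obtain ⟨G, hG⟩ := exists_koszul_form hB
  have hd : ∀ t : ℝ, HasDerivAt (fun s : ℝ => (s / T) • f) (T⁻¹ • f) t := fun t => by
    have h := ((hasDerivAt_id t).div_const T).smul_const f
    rwa [one_div] at h
  have hderiv : deriv (fun s : ℝ => (s / T) • f) = fun _ => T⁻¹ • f := funext fun t => (hd t).deriv
  have hGf : G f f = 0 := hB.1 _ fun c => by
    have h := hG f f c
    rw [hf] at h
    linarith
  refine ⟨⟨?_, fun t => ?_⟩, fun t => ?_⟩
  · exact (contDiff_id.div_const T).smul contDiff_const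
  · change deriv (deriv fun s : ℝ => (s / T) • f) t + christoffel B _
      (deriv (fun s : ℝ => (s / T) • f) t) (deriv (fun s : ℝ => (s / T) • f) t) = 0
    rw [christoffel_eq hsymm hB hperp hcoiso hG, hderiv, deriv_const, map_smul, map_smul,
      LinearMap.smul_apply, hGf]
    simp
  · have h1 : speedSq B (fun t => exp ((t / T) • f)) t = B f f / T ^ 2 := by
      rw [speedSq_eq hsymm hperp]
      change B (deriv (fun s : ℝ => (s / T) • f) t) (deriv (fun s : ℝ => (s / T) • f) t)
        - B (deriv (fun s : ℝ => (s / T) • f) t)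
          ⁅(t / T) • f, deriv (fun s : ℝ => (s / T) • f) t⁆ = _
      rw [hderiv, lie_smul, smul_lie, lie_self]
      simp only [map_smul, LinearMap.smul_apply, smul_eq_mul, smul_zero, map_zero, sub_zero]
      field_simp
    have h2 : 0 < T ^ 2 := pow_pos hT 2
    rw [h1, abs_div, abs_of_pos h2, ← hfT, div_self h2.ne']

end Koszul

/-! ### Lattices -/

section Lattice

variable {Γ : Subgroup (NilGroup 𝔫)}

/-- A linear functional that kills brackets is a homomorphism on the group; if it kills a lattice,
it descends to a continuous function on the compact orbit space, so it is bounded, so it is zero. -/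
theorem eq_zero_of_eq_zero_on_logSet (hΓ : IsLattice Γ) (l : 𝔫 →ₗ[ℝ] ℝ)
    (hl : ∀ x y : 𝔫, l ⁅x, y⁆ = 0) (hlΓ : ∀ y ∈ logSet Γ, l y = 0) (y : 𝔫) : l y = 0 := by
  have := hΓ.cocompact
  have hinv : ∀ a b : NilGroup 𝔫, MulAction.orbitRel Γ (NilGroup 𝔫) a b → l a.log = l b.log := by
    rintro _ b ⟨g, rfl⟩
    change l ((g : NilGroup 𝔫) * b).log = _
    rw [log_mul, map_add, map_add, map_smul, hl, hlΓ _ g.2]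
    simp
  let F : Nilmanifold Γ → ℝ := Quotient.lift (fun n : NilGroup 𝔫 => l n.log) hinv
  have hF : Continuous F :=
    ((LinearMap.toContinuousLinearMap l).continuous.comp logHomeomorph.continuous).quotient_lift hinv
  obtain ⟨M, hM⟩ := (isCompact_range hF).bddAbove
  have hle : ∀ s : ℝ, s * l y ≤ M := fun s => by
    have h : F (proj Γ (exp (s • y))) ≤ M := hM (Set.mem_range_self _)
    change l (s • y) ≤ M at h
    rwa [map_smul, smul_eq_mul] at h
  by_contra hy
  have h := hle ((M + 1) / l y)
  rw [div_mul_cancel₀ _ hy] at h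
  linarith

/-- Discreteness of `Γ`: if the projection of `γ` to the orbit space has period `T`, the element
of `Γ` that carries `γ t` to `γ (t + T)` does not depend on `t`. -/
theorem mul_eq_of_proj_eq (hΓ : IsLattice Γ) {γ : ℝ → NilGroup 𝔫}
    (hγ : Continuous fun t => (γ t).log) {T : ℝ}
    (hper : ∀ t, proj Γ (γ (t + T)) = proj Γ (γ t)) {φ : Γ} (hφ : γ T = (φ : NilGroup 𝔫) * γ 0) :
    Translates (φ : NilGroup 𝔫) γ T := by
  have := hΓ.discrete
  have hmem : ∀ t, γ (t + T) * (γ t)⁻¹ ∈ Γ := fun t => by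
    obtain ⟨g, hg⟩ : MulAction.orbitRel Γ (NilGroup 𝔫) (γ (t + T)) (γ t) := Quotient.exact (hper t)
    change (g : NilGroup 𝔫) * γ t = γ (t + T) at hg
    rw [← hg, mul_inv_cancel_right]
    exact g.2
  have hγ' : Continuous γ := continuous_induced_rng.2 hγ
  have : IsTopologicalGroup (NilGroup 𝔫) := topologicalGroup_of_lieGroup (modelWithCornersSelf ℝ 𝔫) ω
  have hcont : Continuous fun t => (⟨γ (t + T) * (γ t)⁻¹, hmem t⟩ : Γ) :=
    ((hγ'.comp (continuous_id.add continuous_const)).mul hγ'.inv).subtype_mk hmem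
  intro t
  have h := congrArg Subtype.val (PreconnectedSpace.constant inferInstance hcont (x := t) (y := 0))
  change γ (t + T) * (γ t)⁻¹ = γ (0 + T) * (γ 0)⁻¹ at h
  rw [zero_add, hφ, mul_inv_cancel_right] at h
  rw [← h, inv_mul_cancel_right]

end Lattice

/-- The period spectrum of a lattice, without reference to the splitting. -/
theorem mem_periodSpectrum_iff {B : LinearMap.BilinForm ℝ 𝔫} (hsymm : B.IsSymm)
    (hB : B.Nondegenerate)
    (hperp : ∀ x y : 𝔫, ∀ c ∈ LieAlgebra.center ℝ 𝔫, B ⁅x, y⁆ c = 0)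
    (hcoiso : ∀ w : 𝔫, (∀ c ∈ LieAlgebra.center ℝ 𝔫, B w c = 0) → w ∈ LieAlgebra.center ℝ 𝔫)
    {Γ : Subgroup (NilGroup 𝔫)} (hΓ : IsLattice Γ) {T : ℝ} :
    T ∈ periodSpectrum B Γ ↔
      0 < T ∧ ∃ f ∈ logSet Γ, (∀ y ∈ logSet Γ, B f ⁅f, y⁆ = 0) ∧ T ^ 2 = |B f f| := by
  simp only [periodSpectrum, Set.mem_iUnion]
  constructor
  · rintro ⟨C, hT, γ, hγ, hper, φ, -, hφ⟩
    have htr := mul_eq_of_proj_eq hΓ hγ.1.1.continuous hper hφ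
    obtain ⟨h1, h2⟩ := speedSq_mul_sq_and_apply_lie_eq_zero hsymm hB hperp hcoiso hγ.1 hT.ne' htr
    refine ⟨hT, (φ : NilGroup 𝔫).log, φ.2, fun y _ => h2 y, ?_⟩
    rw [← h1, abs_mul, hγ.2 0, one_mul, abs_of_nonneg (sq_nonneg T)]
  · rintro ⟨hT, f, hf, hfΓ, hfT⟩
    have hff : ∀ y : 𝔫, B f ⁅f, y⁆ = 0 := by
      let ad : 𝔫 →ₗ[ℝ] Module.End ℝ 𝔫 := LieAlgebra.ad ℝ 𝔫
      refine eq_zero_of_eq_zero_on_logSet hΓ (B f ∘ₗ ad f) (fun x y => ?_) hfΓ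
      change B f ⁅f, ⁅x, y⁆⁆ = 0
      rw [lie_lie_right, map_zero]
    have htr : ∀ t, (exp f : NilGroup 𝔫) * exp ((t / T) • f) = exp (((t + T) / T) • f) := by
      intro t
      ext1
      rw [log_mul]
      change f + (t / T) • f + (1 / 2 : ℝ) • ⁅f, (t / T) • f⁆ = _
      rw [lie_smul, lie_self, smul_zero, smul_zero, add_zero, add_div, div_self hT.ne', add_smul,
        one_smul, add_comm]
    refine ⟨⟨ConjClasses.mk ⟨exp f, hf⟩, fun h => ?_⟩, hT, fun t => exp ((t / T) • f),
      isUnitSpeedGeodesic_line hsymm hB hperp hcoiso hff hT hfT, fun t => ?_, ⟨exp f, hf⟩, rfl, ?_⟩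
    · have h1 := ConjClasses.mk_eq_mk_iff_isConj.1 h
      rw [isConj_one_left] at h1
      have h2 : f = 0 := congrArg (fun g : Γ => (g : NilGroup 𝔫).log) h1
      rw [h2, map_zero, abs_zero] at hfT
      exact (pow_pos hT 2).ne' hfT
    · exact Quotient.sound ⟨⟨exp f, hf⟩, htr t⟩
    · have h := htr 0
      rw [zero_add] at h
      exact h.symm

end PseudoNil

end

theorem mainTheorem4 {𝔫 : Type*} [PseudoNil.NormedLieAlgebra 𝔫] [FiniteDimensional ℝ 𝔫]
    [PseudoNil.TwoStep 𝔫] (B : LinearMap.BilinForm ℝ 𝔫) (hsymm : B.IsSymm)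
    (hnondeg : B.Nondegenerate) (U Z V E : Submodule ℝ 𝔫)
    (hsplit : PseudoNil.IsSplitting B U Z V E)
    (hU : ∀ x y : 𝔫, ⁅x, y⁆ ∈ U) (hE : E = ⊥) :
    PseudoNil.IsFlat B ∧
    (∀ (φ : PseudoNil.NilGroup 𝔫) (γ : ℝ → PseudoNil.NilGroup 𝔫) (T : ℝ), 0 < T →
      PseudoNil.IsUnitSpeedGeodesic B γ → PseudoNil.Translates φ γ T →
      ∀ u ∈ U, ∀ z ∈ Z, ∀ v ∈ V, φ.log = u + z + v →
        PseudoNil.speedSq B γ 0 * T ^ 2 = 2 * B u v + B z z) ∧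
    (∀ Γ : Subgroup (PseudoNil.NilGroup 𝔫), PseudoNil.IsLattice Γ →
      PseudoNil.periodSpectrum B Γ =
        {T : ℝ | 0 < T ∧ ∃ u ∈ U, ∃ z ∈ Z, ∃ v ∈ V, u + z + v ∈ PseudoNil.logSet Γ ∧
          (∀ y ∈ PseudoNil.logSet Γ, B v ⁅v, y⁆ = 0) ∧ T ^ 2 = |2 * B u v + B z z|}) := by
  have hperp : ∀ x y : 𝔫, ∀ c ∈ LieAlgebra.center ℝ 𝔫, B ⁅x, y⁆ c = 0 := fun x y =>
    ((hsplit.mem_U _).1 (hU x y)).2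
  have hcoiso : ∀ w : 𝔫, (∀ c ∈ LieAlgebra.center ℝ 𝔫, B w c = 0) →
      w ∈ LieAlgebra.center ℝ 𝔫 := fun w => hsplit.mem_center_of_perp hE hsymm hnondeg
  obtain ⟨G, hG⟩ := PseudoNil.exists_koszul_form hnondeg
  refine ⟨PseudoNil.isFlat_of_koszul hsymm hnondeg hperp hcoiso hG, ?_, fun Γ hΓ => ?_⟩
  · intro φ γ T hT hγ hφ u hu z hz v hv h
    rw [(PseudoNil.speedSq_mul_sq_and_apply_lie_eq_zero hsymm hnondeg hperp hcoiso hγ.1 hT.ne'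
      hφ).1, h, hsplit.apply_self hsymm hu hz hv]
  -- Only the `V` component of `f` enters `⟨f, [f, y]⟩`.
  have hlie : ∀ u ∈ U, ∀ z ∈ Z, ∀ v y : 𝔫, B (u + z + v) ⁅u + z + v, y⁆ = B v ⁅v, y⁆ := by
    intro u hu z hz v y
    have huz : u + z ∈ LieAlgebra.center ℝ 𝔫 :=
      add_mem ((hsplit.mem_U u).1 hu).1 ((hsplit.mem_Z z).1 hz).1
    rw [add_lie, PseudoNil.lie_eq_zero_of_mem_center_left huz, zero_add, map_add,
      LinearMap.add_apply, hsymm.eq (u + z), hperp v y _ huz, zero_add]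
  ext T
  rw [PseudoNil.mem_periodSpectrum_iff hsymm hnondeg hperp hcoiso hΓ]
  refine and_congr_right fun _ => ⟨?_, ?_⟩
  · rintro ⟨f, hf, hfΓ, hfT⟩
    obtain ⟨u, hu, z, hz, v, hv, rfl⟩ := hsplit.exists_add_eq hE f
    refine ⟨u, hu, z, hz, v, hv, hf, fun y hy => ?_, ?_⟩
    · rw [← hlie u hu z hz, hfΓ y hy]
    · rw [hfT, hsplit.apply_self hsymm hu hz hv]
  · rintro ⟨u, hu, z, hz, v, hv, hf, hfΓ, hfT⟩
    refine ⟨u + z + v, hf, fun y hy => ?_, ?_⟩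
    · rw [hlie u hu z hz, hfΓ y hy]
    · rw [hfT, hsplit.apply_self hsymm hu hz hv]
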